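/- Let $\mathcal X,\mathcal Y$ be finite alphabets, $p_0$ a probability mass function on $\mathcal X$ and $p_{Y|X}$ a conditional probability mass function on $\mathcal Y$ given $\mathcal X$. For mass functions $p,q$ on a finite set put $\|p-q\|_{TV}=\frac12\sum_a|p(a)-q(a)|$, and let $N_\Delta(p)$ be the set of probability mass functions $q$ with $\|p-q\|_{TV}\le\Delta$. The joint type of $(x^n,y^n)\in\mathcal X^n\times\mathcal Y^n$ is $P_{x^n,y^n}(x,y)=\frac1n\sum_{i=1}^n\mathbf 1((x_i,y_i)=(x,y))$. In the two-node network, a $(2^{nR},n)$ coordination code consists of an encoding function $i:\mathcal X^n\to\{1,\dots,\lfloor 2^{nR}\rfloor\}$ and a decoding function $y^n:\{1,\dots,\lfloor 2^{nR}\rfloor\}\to\mathcal Y^n$. The actions $X^n$ are i.i.d. according to $p_0$, and $Y^n=y^n(i(X^n))$. For $(R,\Delta)\in\mathbb R^2$, the distribution $p_0p_{Y|X}$ is achievable for $\Delta$-empirical coordination with rate $R$ if there is an $N$ such that for all $n>N$ there is a $(2^{nR},n)$ coordination code with $\mathbb E\|P_{X^n,Y^n}-p_0p_{Y|X}\|_{TV}\le\Delta$.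 The rate-distortion-coordination region $R^I_{p_0}(p_{Y|X})$ is the closure in $\mathbb R^2$ of the set of pairs $(R,\Delta)$ for which this holds. Then, for every $p_0$ and $p_{Y|X}$, $$R^I_{p_0}(p_{Y|X})=\Big\{(R,\Delta):\ \Delta\ge 0,\ R\ge\min_{q_{\hat Y|X}:\ p_0q_{\hat Y|X}\in N_\Delta(p_0p_{Y|X})}I(X;\hat Y)\Big\},$$ where $q_{\hat Y|X}$ ranges over the conditional probability mass functions on $\mathcal Y$ given $\mathcal X$, $I(X;\hat Y)$ is the mutual information in bits of a pair $(X,\hat Y)$ with distribution $p_0q_{\hat Y|X}$, and the minimum is attained for every $\Delta\ge0$. -/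

import Mathlib

noncomputable section

namespace Coordination

/-- Joint probability mass function `p₀(x) p(y|x)` of a source and a conditional distribution. -/
def joint {X Y : Type*} (p₀ : X → ℝ) (p : X → Y → ℝ) : X × Y → ℝ :=
  fun a => p₀ a.1 * p a.1 a.2

/-- The conditional probability mass functions on `Y` given `X`. -/
def condPMFs (X Y : Type*) [Fintype Y] : Set (X → Y → ℝ) :=
  {p | ∀ x, p x ∈ stdSimplex ℝ Y}

/-- Total variation between two mass functions on a finite set. -/
def tv {A : Type*} [Fintype A] (p q : A → ℝ) : ℝ :=
  1 / 2 * ∑ a, |p a - q a|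

/-- The `Δ`-neighbourhood of `p`: all probability mass functions within total variation `Δ`. -/
def nbhd {A : Type*} [Fintype A] (Δ : ℝ) (p : A → ℝ) : Set (A → ℝ) :=
  {q | q ∈ stdSimplex ℝ A ∧ tv p q ≤ Δ}

/-- Joint type (empirical distribution) of a pair of sequences of length `n`. -/
def jointType {X Y : Type*} [DecidableEq X] [DecidableEq Y] {n : ℕ}
    (xs : Fin n → X) (ys : Fin n → Y) : X × Y → ℝ :=
  fun a => 1 / (n : ℝ) * ∑ i : Fin n, if (xs i, ys i) = a then (1 : ℝ) else 0

/-- A `(2^{nR}, n)` coordination code for the two-node network. The message set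
`{1, …, 2^{nR}}` consists of the positive integers that are at most `2^{nR}`. -/
structure Code (X Y : Type*) (R : ℝ) (n : ℕ) where
  /-- encoding function -/
  encode : (Fin n → X) → Fin ⌊(2 : ℝ) ^ ((n : ℝ) * R)⌋₊
  /-- decoding function -/
  decode : Fin ⌊(2 : ℝ) ^ ((n : ℝ) * R)⌋₊ → (Fin n → Y)

/-- The action sequence `Y^n` that a code produces from `X^n = xs`. -/
def Code.output {X Y : Type*} {R : ℝ} {n : ℕ} (c : Code X Y R n) (xs : Fin n → X) : Fin n → Y :=
  c.decode (c.encode xs)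

/-- Expectation of `f (X^n)` for `X^n` i.i.d. according to `p₀`. -/
def iidExpect {X : Type*} [Fintype X] (p₀ : X → ℝ) {n : ℕ} (f : (Fin n → X) → ℝ) : ℝ :=
  ∑ xs : Fin n → X, (∏ i, p₀ (xs i)) * f xs

/-- `p₀(x) p(y|x)` is achievable for `Δ`-empirical coordination with rate `R`. -/
def Achievable {X Y : Type*} [Fintype X] [Fintype Y] [DecidableEq X] [DecidableEq Y]
    (p₀ : X → ℝ) (p : X → Y → ℝ) (R Δ : ℝ) : Prop :=
  ∃ N : ℕ, ∀ n : ℕ, N < n → ∃ c : Code X Y R n,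
    iidExpect p₀ (fun xs => tv (jointType xs (c.output xs)) (joint p₀ p)) ≤ Δ

/-- Rate-distortion-coordination region: the closure of the achievable pairs `(R, Δ)`. -/
def region {X Y : Type*} [Fintype X] [Fintype Y] [DecidableEq X] [DecidableEq Y]
    (p₀ : X → ℝ) (p : X → Y → ℝ) : Set (ℝ × ℝ) :=
  closure {v : ℝ × ℝ | Achievable p₀ p v.1 v.2}

/-- Mutual information, in bits, of a pair with joint probability mass function `w`. Terms
with `w (x, y) = 0` vanish, and both marginals are positive wherever `w` is. -/
def mutualInfo {X Y : Type*} [Fintype X] [Fintype Y] (w : X × Y → ℝ) : ℝ :=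
  ∑ x, ∑ y, w (x, y) * Real.logb 2 (w (x, y) / ((∑ y', w (x, y')) * ∑ x', w (x', y)))

/-- The conditional distributions `q` with `p₀ q` in the `Δ`-neighbourhood of `p₀ p`. -/
def feasible {X Y : Type*} [Fintype X] [Fintype Y]
    (p₀ : X → ℝ) (p : X → Y → ℝ) (Δ : ℝ) : Set (X → Y → ℝ) :=
  {q | q ∈ condPMFs X Y ∧ joint p₀ q ∈ nbhd Δ (joint p₀ p)}

/-- The values of `I(X; Ŷ)` over the feasible conditional distributions. -/
def feasibleInfo {X Y : Type*} [Fintype X] [Fintype Y]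
    (p₀ : X → ℝ) (p : X → Y → ℝ) (Δ : ℝ) : Set ℝ :=
  (fun q => mutualInfo (joint p₀ q)) '' feasible p₀ p Δ

end Coordination

end

/-! Converse: a code of a single block length suffices. Its mean joint type `w` has `X`-marginal
`p₀`, because every `X_i` has law `p₀`, and by convexity its distance to `p₀ p` is at most the
expected distance. With `g = w / (p₀ r)`, `r` the `Y`-marginal, `n I(w)` is the expected log of `∏
g(x_i, y_i)`. That product is at most its sum over all `M` codewords, and each fixed codeword
contributes expectation at most 1, so `log t ≤ t - 1` gives `n I(w) ≤ log M`
(`mul_mutualInfo_meanType_le`). Neither the chain rule nor convexity of mutual information is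
needed.

Achievability: for `R > I(w)`, draw `2^{nR}` codewords i.i.d. from the product of `Y`-marginals. By
`exists_covering` some codebook has, for most source sequences, a word jointly typical with the
source; typicality is controlled by Chebyshev (`eventually_exists_code`).

Closure: minimising over a compact set of conditionals makes the right-hand side closed, and each of
its points is a limit of points with both inequalities strict, where random coding applies. -/

namespace Coordination

/-! ### Expectations and second moments under i.i.d. laws -/

section Expectation

variable {A : Type*} [Fintype A] {w : A → ℝ} {n : ℕ}

lemma iidExpect_prod (w : A → ℝ) (f : Fin n → A → ℝ) :
    iidExpect w (fun xs => ∏ i, f i (xs i)) = ∏ i, ∑ a, w a * f i a := by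
  classical
  simp only [iidExpect, ← Finset.prod_mul_distrib]
  rw [Finset.prod_univ_sum, Fintype.piFinset_univ]

lemma iidExpect_one (hw : ∑ a, w a = 1) : iidExpect w (fun _ : Fin n → A => (1 : ℝ)) = 1 := by
  simpa [hw] using iidExpect_prod (n := n) w (fun _ _ => 1)

lemma iidExpect_add (w : A → ℝ) (f g : (Fin n → A) → ℝ) :
    iidExpect w (fun xs => f xs + g xs) = iidExpect w f + iidExpect w g := by
  simp [iidExpect, mul_add, Finset.sum_add_distrib]

lemma iidExpect_const_mul (w : A → ℝ) (c : ℝ) (f : (Fin n → A) → ℝ) :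
    iidExpect w (fun xs => c * f xs) = c * iidExpect w f := by
  simp only [iidExpect, Finset.mul_sum]
  exact Finset.sum_congr rfl fun _ _ => by ring

lemma iidExpect_const (hw : ∑ a, w a = 1) (c : ℝ) :
    iidExpect w (fun _ : Fin n → A => c) = c := by
  simpa [iidExpect_one hw] using iidExpect_const_mul (n := n) w c (fun _ => 1)

lemma iidExpect_sum {ι : Type*} (s : Finset ι) (w : A → ℝ) (f : ι → (Fin n → A) → ℝ) :
    iidExpect w (fun xs => ∑ j ∈ s, f j xs) = ∑ j ∈ s, iidExpect w (f j) := by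
  simp only [iidExpect, Finset.mul_sum]
  exact Finset.sum_comm

/-- Comparing only on the support keeps later logarithms away from zero. -/
lemma iidExpect_le (hw : ∀ a, 0 ≤ w a) {f g : (Fin n → A) → ℝ}
    (h : ∀ xs, 0 < ∏ i, w (xs i) → f xs ≤ g xs) : iidExpect w f ≤ iidExpect w g := by
  refine Finset.sum_le_sum fun xs _ => ?_
  rcases (Finset.prod_nonneg fun i _ => hw (xs i) : 0 ≤ ∏ i, w (xs i)).eq_or_lt with h0 | h0
  · simp [← h0]
  · exact mul_le_mul_of_nonneg_left (h xs h0) h0.le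

lemma iidExpect_apply (hw : ∑ a, w a = 1) (i : Fin n) (f : A → ℝ) :
    iidExpect w (fun xs => f (xs i)) = ∑ a, w a * f a := by
  classical
  have h := iidExpect_prod w (fun j a => if j = i then f a else 1)
  have h1 : ∀ j, (∑ a, w a * if j = i then f a else 1) =
      if j = i then ∑ a, w a * f a else 1 := by
    intro j
    split_ifs <;> simp [hw]
  simpa only [h1, Finset.prod_ite_eq', Finset.mem_univ, if_true] using h

lemma iidExpect_succ (w : A → ℝ) (f : (Fin (n + 1) → A) → ℝ) :
    iidExpect w f = ∑ a, w a * iidExpect w (fun xs : Fin n → A => f (Fin.cons a xs)) := by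
  unfold iidExpect
  rw [← (Fin.consEquiv fun _ : Fin (n + 1) => A).sum_comp, Fintype.sum_prod_type]
  refine Finset.sum_congr rfl fun a _ => ?_
  rw [Finset.mul_sum]
  refine Finset.sum_congr rfl fun xs _ => ?_
  simp [Fin.consEquiv, Fin.prod_univ_succ, mul_assoc]

/-- The second moment of a sum of centred i.i.d. variables. -/
lemma iidExpect_sq_sum (hw : ∑ a, w a = 1) {f : A → ℝ} (hf : ∑ a, w a * f a = 0) :
    iidExpect w (fun xs : Fin n → A => (∑ i, f (xs i)) ^ 2) = n * ∑ a, w a * f a ^ 2 := by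
  induction n with
  | zero => simp [iidExpect]
  | succ n ih =>
    have hS : iidExpect w (fun xs : Fin n → A => ∑ i, f (xs i)) = 0 := by
      rw [iidExpect_sum]
      exact Finset.sum_eq_zero fun i _ => by rw [iidExpect_apply hw, hf]
    have key : ∀ a, iidExpect w (fun xs : Fin n → A =>
        (∑ i, f ((Fin.cons a xs : Fin (n + 1) → A) i)) ^ 2) =
        f a ^ 2 + n * ∑ a, w a * f a ^ 2 := by
      intro a
      have : (fun xs : Fin n → A => (∑ i, f ((Fin.cons a xs : Fin (n + 1) → A) i)) ^ 2) =
          fun xs => (f a ^ 2 + 2 * f a * ∑ i, f (xs i)) + (∑ i, f (xs i)) ^ 2 := by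
        funext xs
        simp only [Fin.sum_univ_succ, Fin.cons_zero, Fin.cons_succ]
        ring
      rw [this, iidExpect_add, iidExpect_add, iidExpect_const hw, iidExpect_const_mul, hS, ih]
      ring
    rw [iidExpect_succ]
    simp only [key, mul_add, Finset.sum_add_distrib]
    rw [← Finset.sum_mul, hw]
    push_cast
    ring

lemma iidExpect_sq_sum_sub (hw : ∑ a, w a = 1) (f : A → ℝ) (hn : 0 < n) :
    iidExpect w (fun xs : Fin n → A => (1 / (n : ℝ) * ∑ i, f (xs i) - ∑ a, w a * f a) ^ 2) =
      (∑ a, w a * (f a - ∑ b, w b * f b) ^ 2) / n := by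
  set μ := ∑ b, w b * f b with hμ
  have hc : ∑ a, w a * (f a - μ) = 0 := by
    simp only [mul_sub, Finset.sum_sub_distrib, ← Finset.sum_mul, hw, ← hμ]
    ring
  have hn' : (n : ℝ) ≠ 0 := by positivity
  have : (fun xs : Fin n → A => (1 / (n : ℝ) * ∑ i, f (xs i) - μ) ^ 2) =
      fun xs => (1 / (n : ℝ)) ^ 2 * (∑ i, (f (xs i) - μ)) ^ 2 := by
    funext xs
    rw [Finset.sum_sub_distrib, Finset.sum_const, Finset.card_univ, Fintype.card_fin,
      nsmul_eq_mul]
    field_simp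
  rw [this, iidExpect_const_mul, iidExpect_sq_sum hw hc]
  field_simp

end Expectation

/-! ### Total variation -/

section TotalVariation

variable {A : Type*} [Fintype A]

lemma tv_nonneg (p q : A → ℝ) : 0 ≤ tv p q := by
  unfold tv
  positivity

lemma tv_triangle (p q r : A → ℝ) : tv p r ≤ tv p q + tv q r := by
  unfold tv
  rw [← mul_add, ← Finset.sum_add_distrib]
  gcongr
  exact abs_sub_le _ _ _

lemma tv_comm (p q : A → ℝ) : tv p q = tv q p := by
  simp [tv, abs_sub_comm]

lemma tv_le_one {p q : A → ℝ} (hp : p ∈ stdSimplex ℝ A) (hq : q ∈ stdSimplex ℝ A) :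
    tv p q ≤ 1 := by
  have : ∑ a, |p a - q a| ≤ ∑ a, (p a + q a) := by
    refine Finset.sum_le_sum fun a _ => ?_
    rw [abs_le]
    constructor <;> linarith [hp.1 a, hq.1 a]
  rw [Finset.sum_add_distrib, hp.2, hq.2] at this
  unfold tv
  linarith

/-- Cauchy–Schwarz; it reduces concentration in total variation to variances of single frequencies.
-/
lemma tv_sq_le (p q : A → ℝ) :
    tv p q ^ 2 ≤ (Fintype.card A : ℝ) / 4 * ∑ a, (p a - q a) ^ 2 := by
  have h := sq_sum_le_card_mul_sum_sq (s := Finset.univ) (f := fun a => |p a - q a|)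
  simp only [sq_abs, Finset.card_univ] at h
  unfold tv
  rw [mul_pow]
  linarith

end TotalVariation

/-! ### Joint types, their mean, and the converse bound -/

section JointType

variable {X Y : Type*} [DecidableEq X] [DecidableEq Y] {n : ℕ}

lemma jointType_nonneg (xs : Fin n → X) (ys : Fin n → Y) (a : X × Y) :
    0 ≤ jointType xs ys a :=
  mul_nonneg (by positivity) (Finset.sum_nonneg fun i _ => by split_ifs <;> norm_num)

lemma jointType_pos (hn : 0 < n) (xs : Fin n → X) (ys : Fin n → Y) (i : Fin n) :
    0 < jointType xs ys (xs i, ys i) := by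
  have hn' : (0 : ℝ) < n := by positivity
  refine mul_pos (by positivity) (Finset.sum_pos' (fun j _ => by split_ifs <;> norm_num) ?_)
  exact ⟨i, Finset.mem_univ i, by simp⟩

variable [Fintype X]

/-- The expected joint type of `X^n` and `out X^n`, for `X^n` i.i.d. according to `p₀`. -/
noncomputable def meanType (p₀ : X → ℝ) (out : (Fin n → X) → Fin n → Y) : X × Y → ℝ :=
  fun a => iidExpect p₀ (fun xs => jointType xs (out xs) a)

variable {p₀ : X → ℝ}

lemma meanType_nonneg (hp₀ : p₀ ∈ stdSimplex ℝ X) (out : (Fin n → X) → Fin n → Y)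
    (a : X × Y) : 0 ≤ meanType p₀ out a :=
  Finset.sum_nonneg fun _ _ =>
    mul_nonneg (Finset.prod_nonneg fun _ _ => hp₀.1 _) (jointType_nonneg _ _ _)

lemma meanType_pos (hp₀ : p₀ ∈ stdSimplex ℝ X) (out : (Fin n → X) → Fin n → Y)
    {xs : Fin n → X} (hxs : 0 < ∏ i, p₀ (xs i)) (i : Fin n) :
    0 < meanType p₀ out (xs i, out xs i) := by
  have hn : 0 < n := Nat.lt_of_le_of_lt (Nat.zero_le _) i.2
  refine Finset.sum_pos' (fun zs _ => mul_nonneg (Finset.prod_nonneg fun _ _ => hp₀.1 _)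
    (jointType_nonneg _ _ _)) ⟨xs, Finset.mem_univ _, mul_pos hxs (jointType_pos hn _ _ i)⟩

variable [Fintype Y]

lemma sum_jointType_mul (xs : Fin n → X) (ys : Fin n → Y) (h : X × Y → ℝ) :
    ∑ a, jointType xs ys a * h a = 1 / (n : ℝ) * ∑ i, h (xs i, ys i) := by
  simp only [jointType, mul_assoc, ← Finset.mul_sum, Finset.sum_mul]
  rw [Finset.sum_comm]
  simp

lemma jointType_mem_stdSimplex (hn : 0 < n) (xs : Fin n → X) (ys : Fin n → Y) :
    jointType xs ys ∈ stdSimplex ℝ (X × Y) := by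
  refine ⟨jointType_nonneg xs ys, ?_⟩
  have h := sum_jointType_mul xs ys (fun _ => 1)
  have hn' : (n : ℝ) ≠ 0 := by positivity
  simpa [hn'] using h

lemma sum_meanType_mul (out : (Fin n → X) → Fin n → Y) (h : X × Y → ℝ) :
    ∑ a, meanType p₀ out a * h a =
      iidExpect p₀ (fun xs => 1 / (n : ℝ) * ∑ i, h (xs i, out xs i)) := by
  simp only [← sum_jointType_mul, meanType]
  rw [iidExpect_sum]
  refine Finset.sum_congr rfl fun a _ => ?_
  rw [mul_comm, ← iidExpect_const_mul]
  simp only [mul_comm]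

lemma sum_meanType_right (hp₀ : p₀ ∈ stdSimplex ℝ X) (hn : 0 < n)
    (out : (Fin n → X) → Fin n → Y) (x : X) : ∑ y, meanType p₀ out (x, y) = p₀ x := by
  have h := sum_meanType_mul (p₀ := p₀) out (fun a => if a.1 = x then 1 else 0)
  have hn' : (n : ℝ) ≠ 0 := by positivity
  rw [iidExpect_const_mul, iidExpect_sum] at h
  simp only [iidExpect_apply hp₀.2 _ (fun a => if a = x then (1 : ℝ) else 0)] at h
  rw [Fintype.sum_prod_type, Finset.sum_eq_single x] at h
  · simpa [hn'] using h
  · intro b _ hb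
    simp [hb]
  · simp

/-- Jensen's inequality for the convex function `tv · v`. -/
lemma tv_meanType_le (hp₀ : p₀ ∈ stdSimplex ℝ X) (out : (Fin n → X) → Fin n → Y)
    (v : X × Y → ℝ) :
    tv (meanType p₀ out) v ≤ iidExpect p₀ (fun xs => tv (jointType xs (out xs)) v) := by
  simp only [tv]
  rw [iidExpect_const_mul, iidExpect_sum]
  gcongr with a
  have h : meanType p₀ out a - v a = iidExpect p₀ (fun xs => jointType xs (out xs) a - v a) := by
    simp only [sub_eq_add_neg]
    rw [iidExpect_add, iidExpect_const hp₀.2]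
    rfl
  rw [h]
  refine (Finset.abs_sum_le_sum_abs _ _).trans (Finset.sum_le_sum fun xs _ => ?_)
  rw [abs_mul, abs_of_nonneg (Finset.prod_nonneg fun _ _ => hp₀.1 _)]

/-- The mean joint type produced by at most `M` codewords has mutual information at most
`(log M) / n`. -/
theorem mul_mutualInfo_meanType_le (hp₀ : p₀ ∈ stdSimplex ℝ X) (hn : 0 < n) {M : ℕ}
    (enc : (Fin n → X) → Fin M) (dec : Fin M → Fin n → Y) :
    n * mutualInfo (meanType p₀ fun xs => dec (enc xs)) ≤ Real.logb 2 M := by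
  obtain ⟨x₀⟩ : Nonempty X := by
    by_contra h
    rw [not_nonempty_iff] at h
    simpa using hp₀.2
  have hM : (0 : ℝ) < M := by
    exact_mod_cast (Nat.zero_le _).trans_lt (enc fun _ => x₀).2
  set out : (Fin n → X) → Fin n → Y := fun xs => dec (enc xs) with hout
  set w := meanType p₀ out with hw
  set r : Y → ℝ := fun y => ∑ x, w (x, y) with hr
  have hw0 : ∀ a, 0 ≤ w a := meanType_nonneg hp₀ out
  have hr0 : ∀ y, 0 ≤ r y := fun y => Finset.sum_nonneg fun x _ => hw0 _
  have hwr : ∀ x y, w (x, y) ≤ r y := fun x y =>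
    Finset.single_le_sum (f := fun x => w (x, y)) (fun x _ => hw0 _) (Finset.mem_univ x)
  set g : X × Y → ℝ := fun a => w a / (p₀ a.1 * r a.2) with hg
  have hg0 : ∀ a, 0 ≤ g a := fun a => div_nonneg (hw0 a) (mul_nonneg (hp₀.1 _) (hr0 _))
  have hn' : (n : ℝ) ≠ 0 := by positivity
  have hI : n * (mutualInfo w * Real.log 2) =
      iidExpect p₀ (fun xs => ∑ i, Real.log (g (xs i, out xs i))) := by
    have h := sum_meanType_mul (p₀ := p₀) out (fun a => Real.log (g a))
    rw [iidExpect_const_mul] at h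
    have h2 : mutualInfo w * Real.log 2 = ∑ a, w a * Real.log (g a) := by
      rw [Fintype.sum_prod_type]
      rw [mutualInfo, Finset.sum_mul]
      refine Finset.sum_congr rfl fun x _ => ?_
      rw [Finset.sum_mul]
      refine Finset.sum_congr rfl fun y _ => ?_
      have : Real.log 2 ≠ 0 := (Real.log_pos one_lt_two).ne'
      rw [show ∑ y', w (x, y') = p₀ x from sum_meanType_right hp₀ hn out x, Real.logb]
      field_simp
      rfl
    rw [h2, h]
    field_simp
  have hlog : iidExpect p₀ (fun xs => ∑ i, Real.log (g (xs i, out xs i))) ≤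
      iidExpect p₀ (fun xs => (Real.log M - 1) +
        1 / (M : ℝ) * ∑ m, ∏ i, g (xs i, dec m i)) := by
    refine iidExpect_le hp₀.1 fun xs hxs => ?_
    have hpos : ∀ i, 0 < g (xs i, out xs i) := by
      intro i
      have h1 := meanType_pos hp₀ out hxs i
      have h2 : p₀ (xs i) ≠ 0 := (Finset.prod_ne_zero_iff.1 hxs.ne') i (Finset.mem_univ i)
      exact div_pos h1 (mul_pos ((hp₀.1 _).lt_of_ne' h2) (h1.trans_le (hwr _ _)))
    have hprod : 0 < ∏ i, g (xs i, out xs i) := Finset.prod_pos fun i _ => hpos i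
    rw [← Real.log_prod fun i _ => (hpos i).ne']
    -- Dividing by `M` before using `log t ≤ t - 1` makes the averaged sum over codewords cancel the
    -- `-1`.
    have h1 : Real.log ((∏ i, g (xs i, out xs i)) / M) ≤ (∏ i, g (xs i, out xs i)) / M - 1 :=
      Real.log_le_sub_one_of_pos (div_pos hprod hM)
    rw [Real.log_div hprod.ne' hM.ne'] at h1
    have h2 : ∏ i, g (xs i, out xs i) ≤ ∑ m, ∏ i, g (xs i, dec m i) :=
      Finset.single_le_sum (f := fun m => ∏ i, g (xs i, dec m i))
        (fun m _ => Finset.prod_nonneg fun i _ => hg0 _) (Finset.mem_univ (enc xs))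
    have h3 := div_le_div_of_nonneg_right h2 hM.le
    rw [one_div_mul_eq_div]
    linarith
  -- Only an inequality: the sum is 0 when `r y = 0`.
  have hone : ∀ y, ∑ x, p₀ x * g (x, y) ≤ 1 := by
    intro y
    calc ∑ x, p₀ x * g (x, y) ≤ ∑ x, w (x, y) / r y := by
          refine Finset.sum_le_sum fun x _ => ?_
          rcases (hp₀.1 x).eq_or_lt with h | h
          · rw [← h, zero_mul]
            exact div_nonneg (hw0 _) (hr0 _)
          · simp only [hg]
            rw [← mul_div_assoc, mul_div_mul_left _ _ h.ne']
      _ = r y / r y := by rw [← Finset.sum_div]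
      _ ≤ 1 := div_self_le_one _
  have hE : iidExpect p₀ (fun xs => (Real.log M - 1) +
        1 / (M : ℝ) * ∑ m, ∏ i, g (xs i, dec m i)) ≤ Real.log M := by
    rw [iidExpect_add, iidExpect_const hp₀.2, iidExpect_const_mul, iidExpect_sum]
    have h1 : ∑ m, iidExpect p₀ (fun xs => ∏ i, g (xs i, dec m i)) ≤ M := by
      calc _ ≤ ∑ _m : Fin M, (1 : ℝ) := by
            refine Finset.sum_le_sum fun m _ => ?_
            rw [iidExpect_prod p₀ (fun i x => g (x, dec m i))]
            exact Finset.prod_le_one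
              (fun i _ => Finset.sum_nonneg fun x _ => mul_nonneg (hp₀.1 _) (hg0 _))
              fun i _ => hone _
        _ = M := by simp
    have h2 : 1 / (M : ℝ) * ∑ m, iidExpect p₀ (fun xs => ∏ i, g (xs i, dec m i)) ≤ 1 := by
      rw [one_div_mul_eq_div]
      exact div_le_one_of_le₀ h1 hM.le
    linarith
  rw [Real.logb, le_div_iff₀ (Real.log_pos one_lt_two), mul_assoc, hI]
  exact hlog.trans hE

end JointType

/-! ### One-shot covering by a random codebook -/

section Covering

lemma exists_le_of_sum_mul_le {C : Type*} [Fintype C] {μ F : C → ℝ} {B : ℝ}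
    (hμ : ∀ c, 0 ≤ μ c) (hμ1 : ∑ c, μ c = 1) (h : ∑ c, μ c * F c ≤ B) : ∃ c, F c ≤ B := by
  by_contra! hlt
  obtain ⟨c, hc⟩ : ∃ c, μ c ≠ 0 := by
    by_contra! h0
    simp [h0] at hμ1
  have : ∑ c, μ c * B < ∑ c, μ c * F c :=
    Finset.sum_lt_sum (fun c _ => mul_le_mul_of_nonneg_left (hlt c).le (hμ c))
      ⟨c, Finset.mem_univ c, mul_lt_mul_of_pos_left (hlt c) ((hμ c).lt_of_ne' hc)⟩
  rw [← Finset.sum_mul, hμ1, one_mul] at this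
  linarith

/-- Convexity of `t ^ M` between `1` and `1 - b`, with weight `a` on the latter, then `1 - b ≤ exp
(-b)`. -/
lemma one_sub_mul_pow_le {a b : ℝ} (ha : 0 ≤ a) (ha1 : a ≤ 1) (hb1 : b ≤ 1) (M : ℕ) :
    (1 - a * b) ^ M ≤ 1 - a + Real.exp (-(b * M)) := by
  have h := (convexOn_pow M).2 (x := (1 : ℝ)) (y := 1 - b) (by simp)
    (by simpa using hb1) (sub_nonneg.2 ha1) ha (by ring)
  simp only [smul_eq_mul, one_pow, mul_one] at h
  have h1 : (1 - b) ^ M ≤ Real.exp (-(b * M)) := by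
    have h2 : 1 - b ≤ Real.exp (-b) := by linarith [Real.add_one_le_exp (-b)]
    calc (1 - b) ^ M ≤ Real.exp (-b) ^ M := pow_le_pow_left₀ (sub_nonneg.2 hb1) h2 M
      _ = Real.exp (-(b * M)) := by
        rw [← Real.exp_nat_mul]
        congr 1
        ring
  have h3 : a * (1 - b) ^ M ≤ Real.exp (-(b * M)) :=
    (mul_le_of_le_one_left (pow_nonneg (sub_nonneg.2 hb1) M) ha1).trans h1
  calc (1 - a * b) ^ M = (1 - a + a * (1 - b)) ^ M := by ring
    _ ≤ _ := by linarith

/-- One-shot covering: some codebook of `M` words covers `u` up to the probability that `(u, v)`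
is not good, plus a doubly exponentially small term. -/
theorem exists_covering {U V : Type*} [Fintype U] [Fintype V] {π : U → V → ℝ} {ρ : V → ℝ}
    (hπ : ∀ u v, 0 ≤ π u v) (hπ1 : ∑ u, ∑ v, π u v = 1) (hρ : ρ ∈ stdSimplex ℝ V)
    {G : U → V → Prop} [∀ u v, Decidable (G u v)] {b : ℝ} (hb1 : b ≤ 1)
    (hG : ∀ u v, G u v → π u v * b ≤ (∑ v', π u v') * ρ v) (M : ℕ) :
    ∃ y : Fin M → V, ∑ u, (∑ v, π u v) * (if ∃ m, G u (y m) then 0 else 1) ≤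
      (∑ u, ∑ v, π u v * if G u v then 0 else 1) + Real.exp (-(b * M)) := by
  -- Probabilistic method: the bound holds on average over codebooks with i.i.d. words of law `ρ`.
  refine exists_le_of_sum_mul_le (μ := fun y : Fin M → V => ∏ m, ρ (y m))
    (fun y => Finset.prod_nonneg fun m _ => hρ.1 _) ?_ ?_
  · simpa [iidExpect] using iidExpect_one (n := M) hρ.2
  have hprod : ∀ u (y : Fin M → V), (if ∃ m, G u (y m) then (0 : ℝ) else 1) =
      ∏ m, if G u (y m) then 0 else 1 := by
    intro u y
    split_ifs with h
    · obtain ⟨m, hm⟩ := h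
      exact (Finset.prod_eq_zero (Finset.mem_univ m) (by simp [hm])).symm
    · push Not at h
      simp [h]
  have hswap : ∑ y : Fin M → V, (∏ m, ρ (y m)) *
        ∑ u, (∑ v, π u v) * (if ∃ m, G u (y m) then 0 else 1) =
      ∑ u, (∑ v, π u v) * (∑ v, ρ v * if G u v then 0 else 1) ^ M := by
    change iidExpect ρ _ = _
    rw [iidExpect_sum]
    refine Finset.sum_congr rfl fun u _ => ?_
    simp only [hprod]
    rw [iidExpect_const_mul, iidExpect_prod ρ (fun _ v => if G u v then 0 else 1)]
    simp
  rw [hswap]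
  -- Given `u`, a random word is good with probability `γ`, and `hG` yields `γ ≥ (S / P) b`, where
  -- `S / P` is the conditional probability of being good under `π`.
  have hterm : ∀ u, (∑ v, π u v) * (∑ v, ρ v * if G u v then 0 else 1) ^ M ≤
      (∑ v, π u v * if G u v then 0 else 1) + (∑ v, π u v) * Real.exp (-(b * M)) := by
    intro u
    set P := ∑ v, π u v with hP
    set S := ∑ v, π u v * if G u v then 1 else 0 with hS
    set γ := ∑ v, ρ v * if G u v then 1 else 0 with hγ
    have hPS : ∑ v, (π u v * if G u v then 0 else 1) = P - S := by
      rw [hP, hS, ← Finset.sum_sub_distrib]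
      exact Finset.sum_congr rfl fun v _ => by split_ifs <;> ring
    have hργ : ∑ v, (ρ v * if G u v then 0 else 1) = 1 - γ := by
      rw [eq_sub_iff_add_eq, hγ, ← Finset.sum_add_distrib]
      refine Eq.trans (Finset.sum_congr rfl fun v _ => ?_) hρ.2
      split_ifs <;> ring
    have h0γ : 0 ≤ 1 - γ := by
      rw [← hργ]
      exact Finset.sum_nonneg fun v _ => mul_nonneg (hρ.1 v) (by split_ifs <;> norm_num)
    have hS0 : 0 ≤ S :=
      Finset.sum_nonneg fun v _ => mul_nonneg (hπ u v) (by split_ifs <;> norm_num)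
    have hSP : S ≤ P := by
      refine Finset.sum_le_sum fun v _ => ?_
      split_ifs
      · simp
      · simpa using hπ u v
    have hSγ : S * b ≤ P * γ := by
      rw [hS, hγ, Finset.sum_mul, Finset.mul_sum]
      refine Finset.sum_le_sum fun v _ => ?_
      split_ifs with h
      · simpa using hG u v h
      · simp
    rw [hPS, hργ]
    rcases (hS0.trans hSP).eq_or_lt with h | h
    · have : S = 0 := le_antisymm (h ▸ hSP) hS0
      simp [← h, this]
    · have h1 : S / P * b ≤ γ := by
        rw [div_mul_eq_mul_div, div_le_iff₀ h]
        linarith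
      have h2 := one_sub_mul_pow_le (div_nonneg hS0 h.le) (div_le_one_of_le₀ hSP h.le) hb1 M
      have h3 : (1 - γ) ^ M ≤ (1 - S / P * b) ^ M :=
        pow_le_pow_left₀ h0γ (by linarith) M
      calc P * (1 - γ) ^ M ≤ P * (1 - S / P + Real.exp (-(b * M))) :=
            mul_le_mul_of_nonneg_left (h3.trans h2) h.le
        _ = P - S + P * Real.exp (-(b * M)) := by field_simp
  refine (Finset.sum_le_sum fun u _ => hterm u).trans ?_
  rw [Finset.sum_add_distrib, ← Finset.sum_mul, hπ1, one_mul]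

end Covering

/-! ### Continuity and nonnegativity of mutual information -/

section MutualInfo

variable {X Y : Type*} [Fintype X] [Fintype Y] {w : X × Y → ℝ}

lemma marginal_pos (hw : ∀ a, 0 ≤ w a) {x : X} {y : Y} (h : w (x, y) ≠ 0) :
    0 < ∑ y', w (x, y') ∧ 0 < ∑ x', w (x', y) := by
  have h' := (hw (x, y)).lt_of_ne' h
  exact ⟨Finset.sum_pos' (fun _ _ => hw _) ⟨y, Finset.mem_univ y, h'⟩,
    Finset.sum_pos' (fun _ _ => hw _) ⟨x, Finset.mem_univ x, h'⟩⟩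

/-- `I = H(X) + H(Y) - H(X,Y)`. In this form continuity also holds where masses vanish. -/
lemma mutualInfo_eq_negMulLog (hw : ∀ a, 0 ≤ w a) :
    mutualInfo w = ((∑ x, Real.negMulLog (∑ y, w (x, y))) + (∑ y, Real.negMulLog (∑ x, w (x, y)))
      - ∑ x, ∑ y, Real.negMulLog (w (x, y))) / Real.log 2 := by
  have h1 : ∑ x, Real.negMulLog (∑ y, w (x, y)) =
      ∑ x, ∑ y, -(w (x, y) * Real.log (∑ y', w (x, y'))) := by
    simp [Real.negMulLog, Finset.sum_mul]
  have h2 : ∑ y, Real.negMulLog (∑ x, w (x, y)) =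
      ∑ x, ∑ y, -(w (x, y) * Real.log (∑ x', w (x', y))) := by
    rw [Finset.sum_comm]
    simp [Real.negMulLog, Finset.sum_mul]
  rw [h1, h2, ← Finset.sum_add_distrib, ← Finset.sum_sub_distrib, Finset.sum_div]
  refine Finset.sum_congr rfl fun x _ => ?_
  rw [← Finset.sum_add_distrib, ← Finset.sum_sub_distrib, Finset.sum_div]
  refine Finset.sum_congr rfl fun y _ => ?_
  by_cases h : w (x, y) = 0
  · simp [h]
  · obtain ⟨ha, hb⟩ := marginal_pos hw h
    rw [Real.logb, Real.log_div h (mul_pos ha hb).ne', Real.log_mul ha.ne' hb.ne', Real.negMulLog]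
    ring

lemma continuousOn_mutualInfo : ContinuousOn (mutualInfo (X := X) (Y := Y)) {w | ∀ a, 0 ≤ w a} := by
  refine ContinuousOn.congr (Continuous.continuousOn ?_) fun w hw => mutualInfo_eq_negMulLog hw
  have := Real.continuous_negMulLog
  fun_prop

/-- Termwise `log t ≥ 1 - 1/t`; the lower bounds sum to `1 - 1 = 0`. -/
lemma mutualInfo_nonneg (hw : w ∈ stdSimplex ℝ (X × Y)) : 0 ≤ mutualInfo w := by
  have h2 : 0 < Real.log 2 := Real.log_pos one_lt_two
  have hs : ∑ x, ∑ y, w (x, y) = 1 := by rw [← Fintype.sum_prod_type, hw.2]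
  have hterm : ∀ x y, (w (x, y) - (∑ y', w (x, y')) * ∑ x', w (x', y)) / Real.log 2 ≤
      w (x, y) * Real.logb 2 (w (x, y) / ((∑ y', w (x, y')) * ∑ x', w (x', y))) := by
    intro x y
    by_cases h : w (x, y) = 0
    · rw [h, zero_mul, zero_sub, neg_div, neg_nonpos]
      exact div_nonneg (mul_nonneg (Finset.sum_nonneg fun _ _ => hw.1 _)
        (Finset.sum_nonneg fun _ _ => hw.1 _)) h2.le
    · obtain ⟨ha, hb⟩ := marginal_pos hw.1 h
      have hpos := (hw.1 (x, y)).lt_of_ne' h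
      rw [Real.logb, ← mul_div_assoc]
      refine div_le_div_of_nonneg_right ?_ h2.le
      have h3 := Real.one_sub_inv_le_log_of_pos (div_pos hpos (mul_pos ha hb))
      refine le_trans (le_of_eq ?_) (mul_le_mul_of_nonneg_left h3 hpos.le)
      field_simp
  refine le_trans (le_of_eq ?_) (Finset.sum_le_sum fun x _ => Finset.sum_le_sum fun y _ => hterm x y)
  simp only [← Finset.sum_div, Finset.sum_sub_distrib, ← Finset.mul_sum, ← Finset.sum_mul, hs]
  rw [Finset.sum_comm, hs]
  simp

end MutualInfo

/-! ### Typicality and random coding -/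

section Achievability

variable {X Y : Type*} [Fintype X] [Fintype Y]

lemma sum_sum_eq_iidExpect {n : ℕ} (w : X × Y → ℝ) (f : (Fin n → X) → (Fin n → Y) → ℝ) :
    ∑ xs : Fin n → X, ∑ ys : Fin n → Y, (∏ i, w (xs i, ys i)) * f xs ys =
      iidExpect w (fun zs => f (fun i => (zs i).1) (fun i => (zs i).2)) := by
  unfold iidExpect
  rw [← (Equiv.arrowProdEquivProdArrow (Fin n) (fun _ => X) (fun _ => Y)).symm.sum_comp,
    Fintype.sum_prod_type]
  rfl

/-- The information density of a pair of symbols with joint distribution `w`, in bits. -/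
noncomputable def infoDensity (w : X × Y → ℝ) (a : X × Y) : ℝ :=
  Real.logb 2 (w a / ((∑ y', w (a.1, y')) * ∑ x', w (x', a.2)))

variable [DecidableEq X] [DecidableEq Y]

/-- Pairs of sequences with joint type close to `w` whose likelihood ratio is at most `2 ^ (n J)`. -/
def Typical (w : X × Y → ℝ) (δ J : ℝ) {n : ℕ} (xs : Fin n → X) (ys : Fin n → Y) : Prop :=
  tv (jointType xs ys) w ≤ δ ∧ (∏ i, w (xs i, ys i)) * (2 : ℝ) ^ (-((n : ℝ) * J)) ≤
    (∏ i, ∑ y, w (xs i, y)) * ∏ i, ∑ x, w (x, ys i)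

open Classical in
-- Chebyshev, for the symbol frequencies and for the mean information density, whose expectation is
-- `mutualInfo w`. The constants `C₁` and `C₂` make the matching squared deviation at least 1
-- whenever a typicality condition fails.
lemma exists_iidExpect_not_typical_le {w : X × Y → ℝ} (hw : w ∈ stdSimplex ℝ (X × Y))
    {δ J : ℝ} (hδ : 0 < δ) (hJ : mutualInfo w < J) :
    ∃ K : ℝ, ∀ n : ℕ, 0 < n → iidExpect w (fun zs : Fin n → X × Y =>
      if Typical w δ J (fun i => (zs i).1) (fun i => (zs i).2) then 0 else 1) ≤ K / n := by
  set I := mutualInfo w with hI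
  have hmean : ∑ a, w a * infoDensity w a = I := by
    rw [Fintype.sum_prod_type]
    rfl
  set C₁ : ℝ := Fintype.card (X × Y) / 4 / δ ^ 2 with hC₁
  set C₂ : ℝ := 1 / (J - I) ^ 2 with hC₂
  have hJI : 0 < J - I := sub_pos.2 hJ
  refine ⟨C₁ * (∑ c : X × Y, ∑ a, w a * ((if a = c then 1 else 0) -
      ∑ b, w b * if b = c then 1 else 0) ^ 2) +
    C₂ * ∑ a, w a * (infoDensity w a - I) ^ 2, fun n hn => ?_⟩
  have hn' : (0 : ℝ) < n := by positivity
  have hbound : iidExpect w (fun zs : Fin n → X × Y =>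
      if Typical w δ J (fun i => (zs i).1) (fun i => (zs i).2) then 0 else 1) ≤
      iidExpect w (fun zs : Fin n → X × Y =>
        C₁ * (∑ c, (1 / (n : ℝ) * (∑ i, if zs i = c then 1 else 0) -
          ∑ b, w b * if b = c then 1 else 0) ^ 2) +
        C₂ * (1 / (n : ℝ) * (∑ i, infoDensity w (zs i)) - ∑ b, w b * infoDensity w b) ^ 2) := by
    refine iidExpect_le hw.1 fun zs hzs => ?_
    have hpos : ∀ i, 0 < w (zs i) := fun i =>
      (hw.1 _).lt_of_ne' ((Finset.prod_ne_zero_iff.1 hzs.ne') i (Finset.mem_univ i))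
    have h0₁ : 0 ≤ C₁ * (∑ c, (1 / (n : ℝ) * (∑ i, if zs i = c then 1 else 0) -
          ∑ b, w b * if b = c then 1 else 0) ^ 2) := by positivity
    have h0₂ : 0 ≤ C₂ * (1 / (n : ℝ) * (∑ i, infoDensity w (zs i)) -
        ∑ b, w b * infoDensity w b) ^ 2 := by positivity
    split_ifs with hT
    · linarith
    rw [Typical, not_and_or, not_le, not_le] at hT
    rcases hT with hT | hT
    · refine le_trans ?_ (le_add_of_nonneg_right h0₂)
      have h1 := tv_sq_le (jointType (fun i => (zs i).1) (fun i => (zs i).2)) w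
      have h2 : δ ^ 2 ≤ tv (jointType (fun i => (zs i).1) (fun i => (zs i).2)) w ^ 2 :=
        pow_le_pow_left₀ hδ.le hT.le 2
      have h3 := h2.trans h1
      rw [hC₁, div_mul_eq_mul_div, le_div_iff₀ (by positivity), one_mul]
      simpa [jointType] using h3
    · refine le_trans ?_ (le_add_of_nonneg_left h0₁)
      have h1 : J < 1 / (n : ℝ) * ∑ i, infoDensity w (zs i) := by
        by_contra! hle
        refine absurd hT (not_lt.2 ?_)
        have hfac : ∀ i, w (zs i) = (2 : ℝ) ^ infoDensity w (zs i) *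
            ((∑ y, w ((zs i).1, y)) * ∑ x, w (x, (zs i).2)) := by
          intro i
          obtain ⟨ha, hb⟩ := marginal_pos hw.1 (x := (zs i).1) (y := (zs i).2) (hpos i).ne'
          rw [infoDensity, Real.rpow_logb two_pos (by norm_num)
            (div_pos (hpos i) (mul_pos ha hb))]
          field_simp
        have hprod : ∏ i, w ((zs i).1, (zs i).2) = (2 : ℝ) ^ (∑ i, infoDensity w (zs i)) *
            ((∏ i, ∑ y, w ((zs i).1, y)) * ∏ i, ∑ x, w (x, (zs i).2)) := by
          rw [Real.rpow_sum_of_pos two_pos, ← Finset.prod_mul_distrib, ← Finset.prod_mul_distrib]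
          exact Finset.prod_congr rfl fun i _ => hfac i
        rw [hprod, mul_right_comm, ← Real.rpow_add two_pos]
        have hnn : 0 ≤ (∏ i, ∑ y, w ((zs i).1, y)) * ∏ i, ∑ x, w (x, (zs i).2) :=
          mul_nonneg (Finset.prod_nonneg fun i _ => Finset.sum_nonneg fun _ _ => hw.1 _)
            (Finset.prod_nonneg fun i _ => Finset.sum_nonneg fun _ _ => hw.1 _)
        refine mul_le_of_le_one_left hnn (Real.rpow_le_one_of_one_le_of_nonpos one_le_two ?_)
        rw [one_div_mul_eq_div, div_le_iff₀ hn'] at hle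
        linarith
      rw [hmean, hC₂, div_mul_eq_mul_div, one_mul, le_div_iff₀ (by positivity), one_mul]
      exact pow_le_pow_left₀ hJI.le (by linarith) 2
  refine hbound.trans (le_of_eq ?_)
  rw [iidExpect_add, iidExpect_const_mul, iidExpect_const_mul, iidExpect_sum]
  simp only [iidExpect_sq_sum_sub hw.2 _ hn,
    fun c => iidExpect_sq_sum_sub hw.2 (fun a => if a = c then (1 : ℝ) else 0) hn]
  rw [hmean, ← Finset.sum_div]
  ring

/-- Random coding: rates above the mutual information of `w` suffice to coordinate `w`. -/
theorem eventually_exists_code {w : X × Y → ℝ} (hw : w ∈ stdSimplex ℝ (X × Y)) {R ε : ℝ}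
    (hR : mutualInfo w < R) (hε : 0 < ε) :
    ∀ᶠ n : ℕ in Filter.atTop, ∃ c : Code X Y R n,
      iidExpect (fun x => ∑ y, w (x, y))
        (fun xs => tv (jointType xs (c.output xs)) w) ≤ ε := by
  classical
  set I := mutualInfo w with hI
  have hI0 : 0 ≤ I := mutualInfo_nonneg hw
  -- The midpoint serves both ends: `J > I` makes atypicality rare, and `J < R` makes `b * M` grow
  -- like `2 ^ (n (R - J))`.
  set J := (I + R) / 2 with hJ
  have hIJ : I < J := by rw [hJ]; linarith
  have hJR : 0 < R - J := by rw [hJ]; linarith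
  obtain ⟨K, hK⟩ := exists_iidExpect_not_typical_le hw (half_pos hε) hIJ
  have hlim : Filter.Tendsto (fun n : ℕ => K / (n : ℝ) +
      Real.exp (-((2 : ℝ) ^ ((n : ℝ) * (R - J)) - 1))) Filter.atTop (nhds (0 + 0)) := by
    refine (tendsto_const_div_atTop_nhds_zero_nat K).add (Real.tendsto_exp_neg_atTop_nhds_zero.comp ?_)
    refine Filter.tendsto_atTop_add_const_right _ (-1) ?_
    exact (tendsto_rpow_atTop_of_base_gt_one 2 one_lt_two).comp
      (tendsto_natCast_atTop_atTop.atTop_mul_const hJR)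
  rw [add_zero] at hlim
  filter_upwards [hlim.eventually (gt_mem_nhds (half_pos hε)), Filter.eventually_gt_atTop 0]
    with n hnε hn
  set M := ⌊(2 : ℝ) ^ ((n : ℝ) * R)⌋₊ with hM
  have hM0 : 0 < M := by
    rw [hM, Nat.floor_pos]
    exact Real.one_le_rpow one_le_two (mul_nonneg n.cast_nonneg (by linarith))
  set b := (2 : ℝ) ^ (-((n : ℝ) * J)) with hb
  have hb1 : b ≤ 1 := Real.rpow_le_one_of_one_le_of_nonpos one_le_two
    (neg_nonpos.2 (mul_nonneg n.cast_nonneg (by linarith)))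
  have hb0 : 0 < b := Real.rpow_pos_of_pos two_pos _
  -- The floor in `M` costs less than one codeword, hence at most `b ≤ 1` here.
  have hbM : (2 : ℝ) ^ ((n : ℝ) * (R - J)) - 1 ≤ b * M := by
    have h1 : (2 : ℝ) ^ ((n : ℝ) * R) - 1 ≤ M := (Nat.sub_one_lt_floor _).le
    have h2 : b * (2 : ℝ) ^ ((n : ℝ) * R) = (2 : ℝ) ^ ((n : ℝ) * (R - J)) := by
      rw [hb, ← Real.rpow_add two_pos]
      congr 1
      ring
    have h3 := mul_le_mul_of_nonneg_left h1 hb0.le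
    rw [mul_sub, h2] at h3
    linarith
  set a : X → ℝ := fun x => ∑ y, w (x, y) with ha
  have ha0 : ∀ x, 0 ≤ a x := fun x => Finset.sum_nonneg fun _ _ => hw.1 _
  have ha1 : ∑ x, a x = 1 := by rw [ha, ← Fintype.sum_prod_type, hw.2]
  have hmarg : ∀ xs : Fin n → X, ∑ ys : Fin n → Y, ∏ i, w (xs i, ys i) = ∏ i, a (xs i) := by
    intro xs
    rw [Finset.prod_univ_sum, Fintype.piFinset_univ]
  have hρ : (fun ys : Fin n → Y => ∏ i, ∑ x, w (x, ys i)) ∈ stdSimplex ℝ (Fin n → Y) := by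
    refine ⟨fun ys => Finset.prod_nonneg fun i _ => Finset.sum_nonneg fun _ _ => hw.1 _, ?_⟩
    have h1 : ∑ y, ∑ x, w (x, y) = 1 := by
      rw [Finset.sum_comm, ← Fintype.sum_prod_type, hw.2]
    simpa [iidExpect] using iidExpect_one (n := n) h1
  obtain ⟨y, hy⟩ := exists_covering (π := fun (xs : Fin n → X) (ys : Fin n → Y) =>
      ∏ i, w (xs i, ys i)) (fun _ _ => Finset.prod_nonneg fun _ _ => hw.1 _)
    (by simpa [iidExpect_one hw.2] using sum_sum_eq_iidExpect (n := n) w (fun _ _ => 1)) hρ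
    (G := fun xs ys => Typical w (ε / 2) J xs ys) hb1
    (fun xs ys h => by rw [hmarg]; exact h.2) M
  rw [sum_sum_eq_iidExpect w (fun xs ys => if Typical w (ε / 2) J xs ys then 0 else 1)] at hy
  simp only [hmarg] at hy
  let c : Code X Y R n :=
    -- Uncovered sequences get an arbitrary message; there the distance is bounded by 1.
    { encode := fun xs => if h : ∃ m, Typical w (ε / 2) J xs (y m) then h.choose else ⟨0, hM0⟩
      decode := y }
  refine ⟨c, ?_⟩
  have hc : ∀ xs, (∃ m, Typical w (ε / 2) J xs (y m)) →
      Typical w (ε / 2) J xs (c.output xs) := by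
    intro xs h
    have : c.encode xs = h.choose := dif_pos h
    rw [Code.output, this]
    exact h.choose_spec
  calc iidExpect a (fun xs => tv (jointType xs (c.output xs)) w)
      ≤ iidExpect a (fun xs => ε / 2 +
          if ∃ m, Typical w (ε / 2) J xs (y m) then 0 else 1) := by
        refine iidExpect_le ha0 fun xs _ => ?_
        split_ifs with h
        · simpa using (hc xs h).1
        · linarith [tv_le_one (jointType_mem_stdSimplex hn xs (c.output xs)) hw]
    _ ≤ ε / 2 + (K / n + Real.exp (-(b * M))) := by
        rw [iidExpect_add, iidExpect_const ha1]
        gcongr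
        exact hy.trans (add_le_add (hK n hn) le_rfl)
    _ ≤ ε / 2 + (K / n + Real.exp (-((2 : ℝ) ^ ((n : ℝ) * (R - J)) - 1))) := by gcongr
    _ ≤ ε := by linarith

end Achievability

/-! ### The region as a projection, and the two inclusions -/

section Region

variable {X Y : Type*} {p₀ : X → ℝ}

lemma continuous_joint (p₀ : X → ℝ) : Continuous (joint p₀ : (X → Y → ℝ) → X × Y → ℝ) := by
  unfold joint
  fun_prop

variable [Fintype Y]

lemma sum_joint_right {q : X → Y → ℝ} (hq : q ∈ condPMFs X Y) (x : X) :
    ∑ y, joint p₀ q (x, y) = p₀ x := by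
  simp only [joint, ← Finset.mul_sum, (hq _).2, mul_one]

lemma isCompact_condPMFs : IsCompact (condPMFs X Y) := by
  have : condPMFs X Y = Set.univ.pi fun _ : X => stdSimplex ℝ Y := by
    ext q
    simp [condPMFs]
  rw [this]
  exact isCompact_univ_pi fun _ => isCompact_stdSimplex ℝ Y

lemma exists_condPMF_joint_eq {p : X → Y → ℝ} (hp : p ∈ condPMFs X Y)
    {w : X × Y → ℝ} (hw : ∀ a, 0 ≤ w a) (hmarg : ∀ x, ∑ y, w (x, y) = p₀ x) :
    ∃ q ∈ condPMFs X Y, joint p₀ q = w := by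
  classical
  -- Off the support of `p₀` the row of `w` vanishes, so any conditional will do there; `p x` is at
  -- hand.
  refine ⟨fun x => if p₀ x = 0 then p x else fun y => w (x, y) / p₀ x, fun x => ?_, ?_⟩
  · by_cases h : p₀ x = 0
    · simpa [h] using hp x
    · simp only [h, if_false]
      refine ⟨fun y => div_nonneg (hw _) ?_, ?_⟩
      · rw [← hmarg x]
        exact Finset.sum_nonneg fun _ _ => hw _
      · rw [← Finset.sum_div, hmarg, div_self h]
  · funext ⟨x, y⟩
    by_cases h : p₀ x = 0
    · have h0 := hmarg x
      rw [h, Finset.sum_eq_zero_iff_of_nonneg fun _ _ => hw _] at h0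
      simp [joint, h, h0 y (Finset.mem_univ y)]
    · simp only [joint, h, if_false]
      field_simp

variable [Fintype X]

lemma joint_mem_stdSimplex (hp₀ : p₀ ∈ stdSimplex ℝ X) {q : X → Y → ℝ} (hq : q ∈ condPMFs X Y) :
    joint p₀ q ∈ stdSimplex ℝ (X × Y) := by
  refine ⟨fun a => mul_nonneg (hp₀.1 _) ((hq _).1 _), ?_⟩
  rw [Fintype.sum_prod_type]
  simp only [joint, ← Finset.mul_sum, (hq _).2, mul_one, hp₀.2]

lemma continuousOn_mutualInfo_joint (hp₀ : p₀ ∈ stdSimplex ℝ X) :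
    ContinuousOn (fun q => mutualInfo (joint p₀ q)) (condPMFs X Y) :=
  continuousOn_mutualInfo.comp (continuous_joint p₀).continuousOn
    fun _ hq => (joint_mem_stdSimplex hp₀ hq).1

lemma continuous_tv_joint (p₀ : X → ℝ) (p : X → Y → ℝ) :
    Continuous fun q => tv (joint p₀ p) (joint p₀ q) := by
  unfold tv joint
  fun_prop

lemma mem_feasible (hp₀ : p₀ ∈ stdSimplex ℝ X) {p q : X → Y → ℝ} {Δ : ℝ} :
    q ∈ feasible p₀ p Δ ↔ q ∈ condPMFs X Y ∧ tv (joint p₀ p) (joint p₀ q) ≤ Δ :=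
  ⟨fun h => ⟨h.1, h.2.2⟩, fun h => ⟨h.1, joint_mem_stdSimplex hp₀ h.1, h.2⟩⟩

theorem isLeast_feasibleInfo (hp₀ : p₀ ∈ stdSimplex ℝ X) {p : X → Y → ℝ}
    (hp : p ∈ condPMFs X Y) {Δ : ℝ} (hΔ : 0 ≤ Δ) :
    IsLeast (feasibleInfo p₀ p Δ) (sInf (feasibleInfo p₀ p Δ)) := by
  have hcompact : IsCompact (feasible p₀ p Δ) := by
    have : feasible p₀ p Δ = condPMFs X Y ∩ {q | tv (joint p₀ p) (joint p₀ q) ≤ Δ} :=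
      Set.ext fun q => mem_feasible hp₀
    rw [this]
    exact isCompact_condPMFs.inter_right
      (isClosed_le (continuous_tv_joint p₀ p) continuous_const)
  have hne : (feasible p₀ p Δ).Nonempty := ⟨p, (mem_feasible hp₀).2 ⟨hp, by simpa [tv] using hΔ⟩⟩
  exact (hcompact.image_of_continuousOn ((continuousOn_mutualInfo_joint hp₀).mono
    fun _ hq => hq.1)).isLeast_sInf (hne.image _)

/-- Since the minimum is attained, the infimum can be traded for a witness `q`, the form in which
both inclusions and closedness are proved. -/
lemma sInf_feasibleInfo_le_iff (hp₀ : p₀ ∈ stdSimplex ℝ X) {p : X → Y → ℝ}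
    (hp : p ∈ condPMFs X Y) {R Δ : ℝ} :
    0 ≤ Δ ∧ sInf (feasibleInfo p₀ p Δ) ≤ R ↔ ∃ q ∈ condPMFs X Y,
      tv (joint p₀ p) (joint p₀ q) ≤ Δ ∧ mutualInfo (joint p₀ q) ≤ R := by
  constructor
  · rintro ⟨hΔ, hR⟩
    obtain ⟨q, hq, hqe⟩ := (isLeast_feasibleInfo hp₀ hp hΔ).1
    exact ⟨q, hq.1, hq.2.2, hqe.trans_le hR⟩
  · rintro ⟨q, hq, hqΔ, hqR⟩
    have hΔ := (tv_nonneg _ _).trans hqΔ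
    exact ⟨hΔ, ((isLeast_feasibleInfo hp₀ hp hΔ).2
      ⟨q, (mem_feasible hp₀).2 ⟨hq, hqΔ⟩, rfl⟩).trans hqR⟩

lemma isClosed_sInf_feasibleInfo_le (hp₀ : p₀ ∈ stdSimplex ℝ X) {p : X → Y → ℝ}
    (hp : p ∈ condPMFs X Y) :
    IsClosed {v : ℝ × ℝ | 0 ≤ v.2 ∧ sInf (feasibleInfo p₀ p v.2) ≤ v.1} := by
  have : CompactSpace (condPMFs X Y) := isCompact_iff_compactSpace.1 isCompact_condPMFs
  have hI : Continuous fun q : condPMFs X Y => mutualInfo (joint p₀ q.1) :=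
    continuousOn_iff_continuous_domRestrict.1 (continuousOn_mutualInfo_joint hp₀)
  have hT : Continuous fun q : condPMFs X Y => tv (joint p₀ p) (joint p₀ q.1) :=
    (continuous_tv_joint p₀ p).comp continuous_subtype_val
  have hcl : IsClosed {z : (ℝ × ℝ) × condPMFs X Y |
      tv (joint p₀ p) (joint p₀ z.2.1) ≤ z.1.2 ∧ mutualInfo (joint p₀ z.2.1) ≤ z.1.1} :=
    (isClosed_le (hT.comp continuous_snd) (by fun_prop)).inter
      (isClosed_le (hI.comp continuous_snd) (by fun_prop))
  -- The set of pairs is the projection of a closed set along the compact space of conditionals.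
  convert isClosedMap_fst_of_compactSpace _ hcl using 1
  ext v
  simp only [Set.mem_ofPred_eq, sInf_feasibleInfo_le_iff hp₀ hp, Set.mem_image]
  constructor
  · rintro ⟨q, hq, h⟩
    exact ⟨(v, ⟨q, hq⟩), h, rfl⟩
  · rintro ⟨z, h, rfl⟩
    exact ⟨z.2.1, z.2.2, h⟩

variable [DecidableEq X] [DecidableEq Y]

theorem Achievable.exists_condPMF (hp₀ : p₀ ∈ stdSimplex ℝ X) {p : X → Y → ℝ}
    (hp : p ∈ condPMFs X Y) {R Δ : ℝ} (h : Achievable p₀ p R Δ) :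
    ∃ q ∈ condPMFs X Y, tv (joint p₀ p) (joint p₀ q) ≤ Δ ∧ mutualInfo (joint p₀ q) ≤ R := by
  obtain ⟨N, hN⟩ := h
  -- One positive block length is enough, as the converse bound is not asymptotic.
  obtain ⟨c, hc⟩ := hN (N + 1) N.lt_succ_self
  obtain ⟨q, hq, hqw⟩ := exists_condPMF_joint_eq (p₀ := p₀) hp (meanType_nonneg hp₀ c.output)
    (sum_meanType_right hp₀ N.succ_pos c.output)
  refine ⟨q, hq, ?_, ?_⟩
  · rw [hqw, tv_comm]
    exact (tv_meanType_le hp₀ c.output _).trans hc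
  · rw [hqw]
    have h1 := mul_mutualInfo_meanType_le hp₀ N.succ_pos c.encode c.decode
    obtain ⟨x₀⟩ : Nonempty X := by
      by_contra h
      rw [not_nonempty_iff] at h
      simpa using hp₀.2
    have hM : 0 < ⌊(2 : ℝ) ^ (((N + 1 : ℕ) : ℝ) * R)⌋₊ :=
      (Nat.zero_le _).trans_lt (c.encode fun _ => x₀).2
    have h2 : Real.logb 2 (⌊(2 : ℝ) ^ (((N + 1 : ℕ) : ℝ) * R)⌋₊ : ℝ) ≤ ((N + 1 : ℕ) : ℝ) * R := by
      rw [Real.logb_le_iff_le_rpow one_lt_two (by exact_mod_cast hM)]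
      exact Nat.floor_le (by positivity)
    exact le_of_mul_le_mul_left (h1.trans h2) (by positivity)

theorem achievable_of_mutualInfo_lt (hp₀ : p₀ ∈ stdSimplex ℝ X) {p q : X → Y → ℝ}
    (hq : q ∈ condPMFs X Y) {R Δ : ℝ} (hR : mutualInfo (joint p₀ q) < R)
    (hΔ : tv (joint p₀ p) (joint p₀ q) < Δ) : Achievable p₀ p R Δ := by
  obtain ⟨N, hN⟩ := Filter.eventually_atTop.1
    (eventually_exists_code (joint_mem_stdSimplex hp₀ hq) hR (sub_pos.2 hΔ))
  refine ⟨N, fun n hn => ?_⟩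
  obtain ⟨c, hc⟩ := hN n hn.le
  simp only [sum_joint_right hq] at hc
  refine ⟨c, ?_⟩
  calc _ ≤ iidExpect p₀ (fun xs => tv (jointType xs (c.output xs)) (joint p₀ q) +
        tv (joint p₀ q) (joint p₀ p)) := iidExpect_le hp₀.1 fun xs _ => tv_triangle _ _ _
    _ ≤ Δ := by
      rw [iidExpect_add, iidExpect_const hp₀.2, tv_comm (joint p₀ q)]
      linarith

theorem region_eq (hp₀ : p₀ ∈ stdSimplex ℝ X) {p : X → Y → ℝ} (hp : p ∈ condPMFs X Y) :
    region p₀ p = {v : ℝ × ℝ | 0 ≤ v.2 ∧ sInf (feasibleInfo p₀ p v.2) ≤ v.1} := by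
  refine Set.Subset.antisymm (closure_minimal (fun v hv => ?_)
    (isClosed_sInf_feasibleInfo_le hp₀ hp)) fun v hv => ?_
  · exact (sInf_feasibleInfo_le_iff hp₀ hp).2 (Achievable.exists_condPMF hp₀ hp hv)
  · obtain ⟨q, hq, hqΔ, hqR⟩ := (sInf_feasibleInfo_le_iff hp₀ hp).1 hv
    -- Raising both coordinates by `t > 0` gives the strict slack that random coding needs.
    have hcont : Continuous fun t : ℝ => ((v.1 + t, v.2 + t) : ℝ × ℝ) := by fun_prop
    have hlim : Filter.Tendsto (fun t : ℝ => ((v.1 + t, v.2 + t) : ℝ × ℝ))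
        (nhdsWithin 0 (Set.Ioi 0)) (nhds v) := by
      have h := (hcont.tendsto 0).mono_left (nhdsWithin_le_nhds (s := Set.Ioi 0))
      simpa using h
    refine mem_closure_of_tendsto hlim ?_
    filter_upwards [self_mem_nhdsWithin] with t ht
    have ht' : 0 < t := ht
    exact achievable_of_mutualInfo_lt hp₀ hq (by linarith) (by linarith)

end Region

end Coordination

theorem lemma2 {X Y : Type*} [Fintype X] [Fintype Y] [DecidableEq X] [DecidableEq Y]
    (p₀ : X → ℝ) (hp₀ : p₀ ∈ stdSimplex ℝ X)
    (p : X → Y → ℝ) (hp : p ∈ Coordination.condPMFs X Y) :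
    (∀ Δ : ℝ, 0 ≤ Δ → IsLeast (Coordination.feasibleInfo p₀ p Δ)
      (sInf (Coordination.feasibleInfo p₀ p Δ))) ∧
    Coordination.region p₀ p =
      {v : ℝ × ℝ | 0 ≤ v.2 ∧ sInf (Coordination.feasibleInfo p₀ p v.2) ≤ v.1} :=
  ⟨fun _ hΔ => Coordination.isLeast_feasibleInfo hp₀ hp hΔ, Coordination.region_eq hp₀ hp⟩
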